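/- Let $\ell, m, n$ be positive integers with $\ell \ge 2n$. Let $N$ be an $n$-dimensional $C^\infty$ manifold without boundary (Hausdorff and second countable), let $U$ be an open subset of $\mathbb{R}^m$, let $f : N \to U$ be a $C^\infty$ immersion, and let $F : U \to \mathbb{R}^\ell$ be a $C^\infty$ mapping. Let $\mathcal{L}(\mathbb{R}^m,\mathbb{R}^\ell)$ denote the space of linear mappings $\mathbb{R}^m \to \mathbb{R}^\ell$, identified with $(\mathbb{R}^m)^\ell$, and for $\pi \in \mathcal{L}(\mathbb{R}^m,\mathbb{R}^\ell)$ set $F_\pi = F + \pi|_U : U \to \mathbb{R}^\ell$. Then there exists a subset $\Sigma$ of $\mathcal{L}(\mathbb{R}^m,\mathbb{R}^\ell)$ of Lebesgue measure zero such that, for every $\pi \in \mathcal{L}(\mathbb{R}^m,\mathbb{R}^\ell) \setminus \Sigma$, the mapping $F_\pi \circ f : N \to \mathbb{R}^\ell$ is a $C^\infty$ immersion. -/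

import Mathlib

open scoped Manifold ContDiff

/-- The linear map `ℝ^m → ℝ^ℓ` whose `i`-th component is `x ↦ ∑ j, a i j * x j`. -/
noncomputable def linearMapOfCoeffs {m ℓ : ℕ} (a : Fin ℓ → Fin m → ℝ) :
    EuclideanSpace ℝ (Fin m) →ₗ[ℝ] EuclideanSpace ℝ (Fin ℓ) :=
  Matrix.toEuclideanLin (Matrix.of a)

/-- The formula for the components of `linearMapOfCoeffs a`. -/
theorem linearMapOfCoeffs_apply {m ℓ : ℕ} (a : Fin ℓ → Fin m → ℝ)
    (x : EuclideanSpace ℝ (Fin m)) (i : Fin ℓ) :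
    linearMapOfCoeffs a x i = ∑ j, a i j * x j := rfl

/-- Every linear map is given by a unique family of coefficients, so that `linearMapOfCoeffs` is
the natural identification of `(ℝ^m)^ℓ` with the space of linear maps. -/
theorem linearMapOfCoeffs_bijective (m ℓ : ℕ) :
    Function.Bijective (linearMapOfCoeffs (m := m) (ℓ := ℓ)) :=
  (Matrix.toEuclideanLin (𝕜 := ℝ) (m := Fin ℓ) (n := Fin m)).bijective.comp
    Matrix.of.bijective

/-- A set of linear maps `ℝ^m → ℝ^ℓ` has Lebesgue measure zero if the corresponding set of
coefficients has (outer) Lebesgue measure zero in `(ℝ^m)^ℓ`. -/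
def HasLebesgueMeasureZero {m ℓ : ℕ}
    (S : Set (EuclideanSpace ℝ (Fin m) →ₗ[ℝ] EuclideanSpace ℝ (Fin ℓ))) : Prop :=
  MeasureTheory.volume {a : Fin ℓ → Fin m → ℝ | linearMapOfCoeffs a ∈ S} = 0

/-- The linear perturbation `F_π = F + π|_U` of a mapping `F : U → ℝ^ℓ`. -/
def linearPerturbation {m ℓ : ℕ} {U : TopologicalSpace.Opens (EuclideanSpace ℝ (Fin m))}
    (F : U → EuclideanSpace ℝ (Fin ℓ))
    (π : EuclideanSpace ℝ (Fin m) →ₗ[ℝ] EuclideanSpace ℝ (Fin ℓ)) :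
    U → EuclideanSpace ℝ (Fin ℓ) :=
  fun x => F x + π (x : EuclideanSpace ℝ (Fin m))

/-!
Write `g` for `f` followed by the inclusion `U ⊆ ℝ^m`, and `h = F ∘ f`, so that
`F_π ∘ f = h + π ∘ g`. In a chart of `N` the derivative of this map at `x` is `Dh x + π ∘ Dg x`, and
`Dg x` is injective because `f` is an immersion. If it has a nonzero kernel vector `w`, then `π`
satisfies the `ℓ` independent affine equations `π (Dg x w) = -Dh x w`. The solutions form a family
of affine spaces of dimension `ℓ m - ℓ`, parametrised by `x` and the line through `w`, that is, by
`2 n - 1` parameters. As `2 n ≤ ℓ`, the bad `π` form a set of Hausdorff dimension at most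
`ℓ m - 1`, which is a null set (`dimH_not_injective_add_comp_le`,
`addHaar_eq_zero_of_dimH_lt`); no form of Sard's theorem beyond "`C¹` maps do not raise
Hausdorff dimension" is needed. Second countability reduces `N` to countably many charts.

Mathlib defines immersions by a local normal form `u ↦ (u, 0)`. Passing from this to injective
differentials uses a local left inverse (`Manifold.IsImmersionAtOfComplement.mfderiv_injective`),
and the way back is the inverse function theorem
(`exists_straightening`, `Manifold.IsImmersionAtOfComplement.of_fderiv_injective`). The complement
in the normal form can be chosen to be the same space at all points, since only its dimension
matters.
-/

open Module Set Topology Filter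

/-! ### The dimension of the set of bad perturbations -/

/-- A map that is `C¹` at every point of `s` is locally Lipschitz on `s`, hence does not raise the
Hausdorff dimension. Unlike `ContDiffOn.dimH_image_le`, no convexity is asked for. -/
theorem dimH_image_le_finrank_of_contDiffAt {X Y : Type*}
    [NormedAddCommGroup X] [NormedSpace ℝ X] [FiniteDimensional ℝ X]
    [NormedAddCommGroup Y] [NormedSpace ℝ Y] {Ψ : X → Y} {s : Set X}
    (h : ∀ x ∈ s, ContDiffAt ℝ 1 Ψ x) : dimH (Ψ '' s) ≤ finrank ℝ X := by
  have : dimH (Ψ '' s) ≤ dimH s := dimH_image_le_of_locally_lipschitzOn fun x hx ↦ by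
    obtain ⟨K, t, ht, hK⟩ := (h x hx).exists_lipschitzOnWith
    exact ⟨K, t, mem_nhdsWithin_of_mem_nhds ht, hK⟩
  exact this.trans ((dimH_mono (subset_univ s)).trans (Real.dimH_univ_eq_finrank X).le)

section
variable {E V W : Type*} [NormedAddCommGroup E] [NormedSpace ℝ E] [FiniteDimensional ℝ E]
  [NormedAddCommGroup V] [NormedSpace ℝ V] [FiniteDimensional ℝ V]
  [NormedAddCommGroup W] [NormedSpace ℝ W] [FiniteDimensional ℝ W]

/-- The part of the bad set seen by two coordinates. If `φ w ≠ 0`, scale `w` so that it has the form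
`e + w'` with `φ w' = 0`. If `ψ u ≠ 0` for `u = P x w`, then `A` is determined by `x`, `w'` and
`A' = A - ψ(·) • A v`, which kills `v`: the equation `A u = -Q x w` gives back
`A v = (ψ u)⁻¹ • (-Q x w - A' u)`. So the set is a `C¹` image of an open part of
`E × ker φ × {A' | A' v = 0}`, of dimension `2 dim E - 1 + dim (V →L W) - dim W`. -/
theorem dimH_kernel_solutions_le {Ω : Set E} (hΩ : IsOpen Ω)
    {P : E → E →L[ℝ] V} {Q : E → E →L[ℝ] W}
    (hP : ContDiffOn ℝ 1 P Ω) (hQ : ContDiffOn ℝ 1 Q Ω)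
    {d : ℕ} (hd : 2 * finrank ℝ E + finrank ℝ (V →L[ℝ] W) ≤ d + finrank ℝ W + 1)
    (φ : E →L[ℝ] ℝ) (ψ : V →L[ℝ] ℝ) (e : E) (v : V) (he : φ e = 1) (hv : ψ v = 1) :
    dimH {A : V →L[ℝ] W | ∃ x ∈ Ω, ∃ w : E, φ w ≠ 0 ∧ ψ (P x w) ≠ 0 ∧
      Q x w + A (P x w) = 0} ≤ d := by
  let ev : (V →L[ℝ] W) →ₗ[ℝ] W := (ContinuousLinearMap.apply ℝ W v).toLinearMap
  have hev : Function.Surjective ev := fun y ↦ ⟨ψ.smulRight y, by simp [ev, hv]⟩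
  have hev_rank : finrank ℝ W + finrank ℝ ev.ker = finrank ℝ (V →L[ℝ] W) := by
    rw [← ev.finrank_range_add_finrank_ker, LinearMap.range_eq_top.2 hev, finrank_top]
  have hφ_rank : finrank ℝ φ.toLinearMap.ker + 1 = finrank ℝ E :=
    Module.Dual.finrank_ker_add_one_of_ne_zero (f := φ.toLinearMap) fun h ↦ by
      have := DFunLike.congr_fun h e
      simp [he] at this
  let prE : E × φ.toLinearMap.ker × ev.ker →L[ℝ] E :=
    φ.toLinearMap.ker.subtypeL ∘L .fst ℝ _ _ ∘L .snd ℝ E _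
  let prA : E × φ.toLinearMap.ker × ev.ker →L[ℝ] V →L[ℝ] W :=
    ev.ker.subtypeL ∘L .snd ℝ _ _ ∘L .snd ℝ E _
  let dir : E × φ.toLinearMap.ker × ev.ker → E := fun p ↦ e + prE p
  let Ψ : E × φ.toLinearMap.ker × ev.ker → (V →L[ℝ] W) := fun p ↦ prA p +
    ψ.smulRight ((ψ (P p.1 (dir p)))⁻¹ • (-Q p.1 (dir p) - prA p (P p.1 (dir p))))
  let s : Set (E × φ.toLinearMap.ker × ev.ker) := {p | p.1 ∈ Ω ∧ ψ (P p.1 (dir p)) ≠ 0}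
  have hΨ : ∀ p ∈ s, ContDiffAt ℝ 1 Ψ p := by
    rintro p ⟨hp, hp'⟩
    have hE := (ContinuousLinearMap.contDiff (n := 1) (𝕜 := ℝ)
      (E := E × φ.toLinearMap.ker × ev.ker) (F := E) prE).contDiffAt (x := p)
    have hA := (ContinuousLinearMap.contDiff (n := 1) (𝕜 := ℝ)
      (E := E × φ.toLinearMap.ker × ev.ker) (F := V →L[ℝ] W) prA).contDiffAt (x := p)
    have hdir : ContDiffAt ℝ 1 dir p := contDiffAt_const.add hE
    have hP1 : ContDiffAt ℝ 1 (fun p : E × φ.toLinearMap.ker × ev.ker ↦ P p.1) p :=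
      (hP.contDiffAt (hΩ.mem_nhds hp)).comp p contDiffAt_fst
    have hQ1 : ContDiffAt ℝ 1 (fun p : E × φ.toLinearMap.ker × ev.ker ↦ Q p.1) p :=
      (hQ.contDiffAt (hΩ.mem_nhds hp)).comp p contDiffAt_fst
    have hP2 := hP1.clm_apply hdir
    have hQ2 := hQ1.clm_apply hdir
    refine hA.add ?_
    refine (ContinuousLinearMap.smulRightL ℝ V W ψ).contDiff.contDiffAt.comp p ?_
    exact ((ψ.contDiff.contDiffAt.comp p hP2).inv hp').smul (hQ2.neg.sub (hA.clm_apply hP2))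
  have hcover : {A : V →L[ℝ] W | ∃ x ∈ Ω, ∃ w : E, φ w ≠ 0 ∧ ψ (P x w) ≠ 0 ∧
      Q x w + A (P x w) = 0} ⊆ Ψ '' s := by
    rintro A ⟨x, hx, w, hw, hw', hA⟩
    have hw₁ : (φ w)⁻¹ • w - e ∈ φ.toLinearMap.ker := by simp [he, hw]
    have hA₁ : A - ψ.smulRight (A v) ∈ ev.ker := by simp [ev, hv]
    have hdir : dir (x, ⟨_, hw₁⟩, ⟨_, hA₁⟩) = (φ w)⁻¹ • w := by
      rw [show dir (x, ⟨_, hw₁⟩, ⟨_, hA₁⟩) = e + ((φ w)⁻¹ • w - e) from rfl, add_sub_cancel]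
    have hne : ψ (P x ((φ w)⁻¹ • w)) ≠ 0 := by simp [hw, hw']
    refine ⟨(x, ⟨_, hw₁⟩, ⟨_, hA₁⟩), ⟨hx, by rw [hdir]; exact hne⟩, ?_⟩
    have hQ' : -Q x ((φ w)⁻¹ • w) = A (P x ((φ w)⁻¹ • w)) := by
      rw [eq_comm, eq_neg_iff_add_eq_zero, map_smul, map_smul, map_smul, ← smul_add, add_comm, hA,
        smul_zero]
    simp only [Ψ, hdir]
    rw [hQ', show prA (x, ⟨_, hw₁⟩, ⟨_, hA₁⟩) = A - ψ.smulRight (A v) from rfl]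
    ext y
    simp only [add_apply, sub_apply, ContinuousLinearMap.smulRight_apply, sub_sub_cancel]
    rw [inv_smul_smul₀ hne]
    abel
  refine (dimH_mono hcover).trans ((dimH_image_le_finrank_of_contDiffAt hΨ).trans ?_)
  have : finrank ℝ (E × φ.toLinearMap.ker × ev.ker) =
      finrank ℝ E + (finrank ℝ φ.toLinearMap.ker + finrank ℝ ev.ker) := by
    simp only [finrank_prod]
  rw [this]
  exact_mod_cast (by omega)

/-- For families `P`, `Q` of linear maps with `P x` injective, the set of perturbations `A` for
which some `Q x + A ∘ P x` fails to be injective has Hausdorff dimension at most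
`2 dim E - 1 + dim (V →L W) - dim W`. A nonzero kernel vector `w` and its image `P x w ≠ 0` both
have a nonzero coordinate, so finitely many sets as in `dimH_kernel_solutions_le` cover it. -/
theorem dimH_not_injective_add_comp_le {Ω : Set E} (hΩ : IsOpen Ω)
    {P : E → E →L[ℝ] V} {Q : E → E →L[ℝ] W}
    (hP : ContDiffOn ℝ 1 P Ω) (hQ : ContDiffOn ℝ 1 Q Ω)
    (hinj : ∀ x ∈ Ω, Function.Injective (P x))
    {d : ℕ} (hd : 2 * finrank ℝ E + finrank ℝ (V →L[ℝ] W) ≤ d + finrank ℝ W + 1) :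
    dimH {A : V →L[ℝ] W | ∃ x ∈ Ω, ¬ Function.Injective (Q x + A ∘L P x)} ≤ d := by
  let b := finBasis ℝ E
  let c := finBasis ℝ V
  have hcover : {A : V →L[ℝ] W | ∃ x ∈ Ω, ¬ Function.Injective (Q x + A ∘L P x)} ⊆
      ⋃ i, ⋃ k, {A : V →L[ℝ] W | ∃ x ∈ Ω, ∃ w : E, (b.coord i).toContinuousLinearMap w ≠ 0 ∧
        (c.coord k).toContinuousLinearMap (P x w) ≠ 0 ∧ Q x w + A (P x w) = 0} := by
    rintro A ⟨x, hx, hA⟩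
    rw [injective_iff_map_eq_zero] at hA
    push Not at hA
    obtain ⟨w, hw, hw0⟩ := hA
    have hPw : P x w ≠ 0 := fun h ↦ hw0 (hinj x hx (by simp [h]))
    obtain ⟨i, hi⟩ : ∃ i, b.coord i w ≠ 0 := by
      by_contra! h
      exact hw0 (b.forall_coord_eq_zero_iff.1 h)
    obtain ⟨k, hk⟩ : ∃ k, c.coord k (P x w) ≠ 0 := by
      by_contra! h
      exact hPw (c.forall_coord_eq_zero_iff.1 h)
    exact mem_iUnion₂.2 ⟨i, k, x, hx, w, hi, hk, hw⟩
  refine (dimH_mono hcover).trans ?_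
  simp only [dimH_iUnion, iSup_le_iff]
  exact fun i k ↦ dimH_kernel_solutions_le hΩ hP hQ hd _ _ (b i) (c k) (by simp) (by simp)

end

/-! ### Immersions and injective differentials -/

section
variable {E E' : Type*} [NormedAddCommGroup E] [NormedSpace ℝ E]
  [NormedAddCommGroup E'] [NormedSpace ℝ E']
  {H : Type*} [TopologicalSpace H] {I : ModelWithCorners ℝ E H}
  {H' : Type*} [TopologicalSpace H'] {J : ModelWithCorners ℝ E' H'}
  {M : Type*} [TopologicalSpace M] [ChartedSpace H M]
  {M' : Type*} [TopologicalSpace M'] [ChartedSpace H' M']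

theorem mfderiv_injective_of_eventually_leftInverse {f : M → M'} {r : M' → M} {x : M}
    (hf : MDifferentiableAt I J f x) (hr : MDifferentiableAt J I r (f x))
    (h : r ∘ f =ᶠ[𝓝 x] id) : Function.Injective (mfderiv I J f x) := by
  have h1 : mfderiv I I (r ∘ f) x = mfderiv I I id x := h.mfderiv_eq
  rw [mfderiv_comp x hr hf, mfderiv_id] at h1
  have h2 : Function.LeftInverse (mfderiv J I r (f x)) (mfderiv I J f x) :=
    fun y ↦ DFunLike.congr_fun h1 y
  exact h2.injective

end

section
variable {E E' F : Type*} [NormedAddCommGroup E] [NormedSpace ℝ E]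
  [NormedAddCommGroup E'] [NormedSpace ℝ E'] [NormedAddCommGroup F] [NormedSpace ℝ F]
  {M : Type*} [TopologicalSpace M] [ChartedSpace E M]
  {M' : Type*} [TopologicalSpace M'] [ChartedSpace E' M']

/-- The differential of an immersion is injective. In the adapted charts the map reads `u ↦ (u, 0)`,
so projecting to the first factor gives a smooth local left inverse. -/
theorem Manifold.IsImmersionAtOfComplement.mfderiv_injective {f : M → M'} {x : M}
    [IsManifold 𝓘(ℝ, E) ∞ M] [IsManifold 𝓘(ℝ, E') ∞ M']
    (h : Manifold.IsImmersionAtOfComplement F 𝓘(ℝ, E) 𝓘(ℝ, E') ∞ f x) :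
    Function.Injective (mfderiv 𝓘(ℝ, E) 𝓘(ℝ, E') f x) := by
  have hform : ∀ y ∈ h.domChart.source, h.codChart (f y) = h.equiv (h.domChart y, 0) := by
    intro y hy
    have hy' : h.domChart y ∈ (h.domChart.extend 𝓘(ℝ, E)).target := by
      simpa using h.domChart.map_source hy
    have := h.writtenInCharts hy'
    simpa [hy] using this
  let r : M' → M := fun z ↦ h.domChart.symm (h.equiv.symm (h.codChart z)).1
  have hx := h.mem_domChart_source
  have hrx : (h.equiv.symm (h.codChart (f x))).1 = h.domChart x := by simp [hform x hx]
  refine mfderiv_injective_of_eventually_leftInverse (r := r)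
    (h.contMDiffAt.mdifferentiableAt (by simp)) ?_ ?_
  · have h1 : MDifferentiableAt 𝓘(ℝ, E') 𝓘(ℝ, E') h.codChart (f x) :=
      (contMDiffAt_of_mem_maximalAtlas h.codChart_mem_maximalAtlas
        h.mem_codChart_source).mdifferentiableAt (by simp)
    have h2 : MDifferentiableAt 𝓘(ℝ, E') 𝓘(ℝ, E) (fun z ↦ (h.equiv.symm z).1)
        (h.codChart (f x)) := by
      rw [mdifferentiableAt_iff_differentiableAt]
      fun_prop
    have h3 : MDifferentiableAt 𝓘(ℝ, E) 𝓘(ℝ, E) h.domChart.symm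
        (h.equiv.symm (h.codChart (f x))).1 := by
      rw [hrx]
      exact (contMDiffAt_symm_of_mem_maximalAtlas h.domChart_mem_maximalAtlas
        (h.domChart.map_source hx)).mdifferentiableAt (by simp)
    exact h3.comp (f x) (h2.comp (f x) h1)
  · filter_upwards [h.domChart.open_source.mem_nhds hx] with y hy
    simp [r, hform y hy, hy]

end

section
variable {E F W : Type*} [NormedAddCommGroup E] [NormedSpace ℝ E] [FiniteDimensional ℝ E]
  [NormedAddCommGroup F] [NormedSpace ℝ F] [FiniteDimensional ℝ F]
  [NormedAddCommGroup W] [NormedSpace ℝ W] [FiniteDimensional ℝ W]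

/-- An injective linear map is, up to an isomorphism of its target, the inclusion of a first factor;
any space `F` of the right dimension can serve as the second factor. -/
theorem ContinuousLinearMap.exists_equiv_prod_of_injective (T : E →L[ℝ] W)
    (hT : Function.Injective T) (hF : finrank ℝ E + finrank ℝ F = finrank ℝ W) :
    ∃ e : (E × F) ≃L[ℝ] W, ∀ x, e (x, 0) = T x := by
  obtain ⟨C, hC⟩ := T.toLinearMap.range.exists_isCompl
  have h1 := Submodule.finrank_add_eq_of_isCompl hC
  rw [LinearMap.finrank_range_of_inj hT] at h1
  let j : F ≃ₗ[ℝ] C := LinearEquiv.ofFinrankEq _ _ (by omega)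
  let e : (E × F) ≃ₗ[ℝ] W :=
    ((LinearEquiv.ofInjective T.toLinearMap hT).prodCongr j).trans
      (Submodule.prodEquivOfIsCompl _ _ hC)
  exact ⟨e.toContinuousLinearEquiv, fun x ↦ by simp [e]⟩

omit [FiniteDimensional ℝ E] [FiniteDimensional ℝ F] in
/-- Straightening by the inverse function theorem: if `e : E × F ≃ W` extends the derivative of `h`
at `x₀`, the map `e (x, z) ↦ h x + e (0, z)` is a local diffeomorphism near `e (x₀, 0)` and carries
`e (x, 0)` to `h x`. -/
theorem exists_straightening {Ω : Set E} (hΩ : IsOpen Ω) {h : E → W} (hh : ContDiffOn ℝ ∞ h Ω)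
    {x₀ : E} (hx₀ : x₀ ∈ Ω) (e : (E × F) ≃L[ℝ] W) (he : ∀ x, e (x, 0) = fderiv ℝ h x₀ x) :
    ∃ χ : OpenPartialHomeomorph W W, e (x₀, 0) ∈ χ.source ∧ ContDiffOn ℝ ∞ χ χ.source ∧
      ContDiffOn ℝ ∞ χ.symm χ.target ∧ ∀ x, χ (e (x, 0)) = h x := by
  let Φ : W → W := fun w ↦ h (e.symm w).1 + e (0, (e.symm w).2)
  let Ω' : Set W := {w | (e.symm w).1 ∈ Ω}
  have hΩ' : IsOpen Ω' := hΩ.preimage (by fun_prop)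
  have hΦ : ContDiffOn ℝ ∞ Φ Ω' := by
    refine (hh.comp (t := Ω) (f := fun w ↦ (e.symm w).1) (by fun_prop) (fun w hw ↦ hw)).add ?_
    fun_prop
  have hx₀' : e (x₀, 0) ∈ Ω' := by simpa [Ω'] using hx₀
  have hΦat : ContDiffAt ℝ ∞ Φ (e (x₀, 0)) := hΦ.contDiffAt (hΩ'.mem_nhds hx₀')
  have hderiv : HasFDerivAt Φ ((ContinuousLinearEquiv.refl ℝ W : W ≃L[ℝ] W) : W →L[ℝ] W)
      (e (x₀, 0)) := by
    have h1 : HasFDerivAt h (fderiv ℝ h x₀) (e.symm (e (x₀, 0))).1 := by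
      simpa using ((hh.contDiffAt (hΩ.mem_nhds hx₀)).differentiableAt (by simp)).hasFDerivAt
    have h2 : HasFDerivAt (fun w ↦ (e.symm w).1)
        (ContinuousLinearMap.fst ℝ E F ∘L (e.symm : W →L[ℝ] E × F)) (e (x₀, 0)) :=
      ContinuousLinearMap.hasFDerivAt
        (ContinuousLinearMap.fst ℝ E F ∘L (e.symm : W →L[ℝ] E × F))
    have h3 : HasFDerivAt (fun w ↦ e (0, (e.symm w).2))
        ((e : E × F →L[ℝ] W) ∘L ContinuousLinearMap.inr ℝ E F ∘L
          ContinuousLinearMap.snd ℝ E F ∘L (e.symm : W →L[ℝ] E × F)) (e (x₀, 0)) :=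
      ContinuousLinearMap.hasFDerivAt ((e : E × F →L[ℝ] W) ∘L ContinuousLinearMap.inr ℝ E F ∘L
          ContinuousLinearMap.snd ℝ E F ∘L (e.symm : W →L[ℝ] E × F))
    have h4 := (h1.comp (e (x₀, 0)) (f := fun w ↦ (e.symm w).1) h2).add h3
    refine h4.congr_fderiv ?_
    ext w
    simp [← he, ← map_add]
  let χ₀ := hΦat.toOpenPartialHomeomorph Φ hderiv (by simp)
  have hχ₀ : (χ₀ : W → W) = Φ := hΦat.toOpenPartialHomeomorph_coe hderiv (by simp)
  -- Smoothness of the inverse needs an invertible derivative on the whole source.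
  let O : Set W := Ω' ∩ fderiv ℝ Φ ⁻¹' range ((↑) : (W ≃L[ℝ] W) → W →L[ℝ] W)
  have hO : IsOpen O := (hΦ.continuousOn_fderiv_of_isOpen hΩ' (by simp)).isOpen_inter_preimage hΩ'
    ContinuousLinearEquiv.isOpen
  refine ⟨χ₀.restr O, ?_, ?_, ?_, ?_⟩
  · rw [OpenPartialHomeomorph.restr_source' _ _ hO]
    exact ⟨hΦat.mem_toOpenPartialHomeomorph_source hderiv (by simp), hx₀', _, hderiv.fderiv.symm⟩
  · rw [OpenPartialHomeomorph.restr_apply, hχ₀]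
    refine hΦ.mono fun w hw ↦ ?_
    rw [OpenPartialHomeomorph.restr_source' _ _ hO] at hw
    exact hw.2.1
  · intro y hy
    have hy' := (χ₀.restr O).map_target hy
    rw [OpenPartialHomeomorph.restr_source' _ _ hO] at hy'
    obtain ⟨-, hyΩ, L, hL⟩ := hy'
    have hd := hΦ.contDiffAt (hΩ'.mem_nhds hyΩ)
    refine ((χ₀.restr O).contDiffAt_symm hy (f₀' := L) ?_ ?_).contDiffWithinAt
    · rw [hL, OpenPartialHomeomorph.restr_apply, hχ₀]
      exact (hd.differentiableAt (by simp)).hasFDerivAt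
    · rw [OpenPartialHomeomorph.restr_apply, hχ₀]
      exact hd
  · intro x
    rw [OpenPartialHomeomorph.restr_apply, hχ₀]
    simp [Φ]

/-- A smooth map into a vector space whose derivative in some chart is injective at a point is an
immersion there, with any prescribed complement of the right dimension. -/
theorem Manifold.IsImmersionAtOfComplement.of_fderiv_injective
    {M : Type*} [TopologicalSpace M] [ChartedSpace E M] [IsManifold 𝓘(ℝ, E) ∞ M]
    {f : M → W} {x : M} (hf : ContMDiff 𝓘(ℝ, E) 𝓘(ℝ, W) ∞ f)
    {c : OpenPartialHomeomorph M E} (hc : c ∈ IsManifold.maximalAtlas 𝓘(ℝ, E) ∞ M)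
    (hx : x ∈ c.source) (hinj : Function.Injective (fderiv ℝ (f ∘ c.symm) (c x)))
    (hF : finrank ℝ E + finrank ℝ F = finrank ℝ W) :
    Manifold.IsImmersionAtOfComplement F 𝓘(ℝ, E) 𝓘(ℝ, W) ∞ f x := by
  have hh : ContDiffOn ℝ ∞ (f ∘ c.symm) c.target :=
    contMDiffOn_iff_contDiffOn.1
      (hf.comp_contMDiffOn (contMDiffOn_symm_of_mem_maximalAtlas hc))
  obtain ⟨e, he⟩ := ContinuousLinearMap.exists_equiv_prod_of_injective (F := F) _ hinj hF
  obtain ⟨χ, hxχ, hχ, hχ', hχe⟩ :=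
    exists_straightening c.open_target hh (c.map_source hx) e he
  have hcont : Continuous fun v : E ↦ e (v, 0) := by fun_prop
  let S : Set M := c.source ∩ c ⁻¹' ((fun v : E ↦ e (v, 0)) ⁻¹' χ.source)
  have hS : IsOpen S := c.isOpen_inter_preimage (χ.open_source.preimage hcont)
  have hform : ∀ y ∈ S, f y ∈ χ.target ∧ χ.symm (f y) = e (c y, 0) := by
    rintro y ⟨hy, hy'⟩
    have : χ (e (c y, 0)) = f y := by simp [hχe, hy]
    rw [← this]
    exact ⟨χ.map_source hy', χ.left_inv hy'⟩
  have hxS : x ∈ S := ⟨hx, hxχ⟩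
  refine Manifold.IsImmersionAtOfComplement.mk_of_continuousAt hf.continuous.continuousAt e
    (c.restr S) χ.symm ?_ (hform x hxS).1 ?_ ?_ ?_
  · rw [c.restr_source' _ hS]
    exact ⟨hx, hxS⟩
  · exact restr_mem_maximalAtlas _ hc hS
  · exact χ.symm.mem_maximalAtlas_of_contMDiffOn hχ'.contMDiffOn
      (by simpa using hχ.contMDiffOn)
  · intro v hv
    have hv' : v ∈ (c.restr S).target := by simpa using hv
    have hvS := (c.restr S).map_target hv'
    rw [c.restr_source' _ hS] at hvS
    have hcv : c ((c.restr S).symm v) = v := (c.restr S).right_inv hv'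
    have := (hform _ hvS.2).2
    rw [hcv] at this
    simpa using this

end

/-! ### Generic linear perturbations of maps on a manifold -/

section
variable {E V W F : Type*} [NormedAddCommGroup E] [NormedSpace ℝ E] [FiniteDimensional ℝ E]
  [NormedAddCommGroup V] [NormedSpace ℝ V] [FiniteDimensional ℝ V]
  [NormedAddCommGroup W] [NormedSpace ℝ W] [FiniteDimensional ℝ W]
  [NormedAddCommGroup F] [NormedSpace ℝ F] [FiniteDimensional ℝ F]
  {M : Type*} [TopologicalSpace M] [SecondCountableTopology M] [ChartedSpace E M]
  [IsManifold 𝓘(ℝ, E) ∞ M]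

omit [FiniteDimensional ℝ E] [FiniteDimensional ℝ V] [SecondCountableTopology M] in
theorem ContMDiff.contDiffOn_comp_chartAt_symm {k : M → V}
    (hk : ContMDiff 𝓘(ℝ, E) 𝓘(ℝ, V) ∞ k) (x : M) :
    ContDiffOn ℝ ∞ (k ∘ (chartAt E x).symm) (chartAt E x).target :=
  contMDiffOn_iff_contDiffOn.1 (hk.comp_contMDiffOn
    (contMDiffOn_symm_of_mem_maximalAtlas (IsManifold.chart_mem_maximalAtlas x)))

/-- Let `g : M → V` be smooth with injective differentials. Then `h + A ∘ g` is an immersion for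
all `A` outside a set of small Hausdorff dimension: the union of the sets of
`dimH_not_injective_add_comp_le` over countably many charts covering `M`. -/
theorem exists_dimH_le_forall_notMem_isImmersion {g : M → V} {h : M → W}
    (hg : ContMDiff 𝓘(ℝ, E) 𝓘(ℝ, V) ∞ g) (hh : ContMDiff 𝓘(ℝ, E) 𝓘(ℝ, W) ∞ h)
    (hinj : ∀ x, Function.Injective (mfderiv 𝓘(ℝ, E) 𝓘(ℝ, V) g x))
    (hF : finrank ℝ E + finrank ℝ F = finrank ℝ W)
    {d : ℕ} (hd : 2 * finrank ℝ E + finrank ℝ (V →L[ℝ] W) ≤ d + finrank ℝ W + 1) :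
    ∃ S : Set (V →L[ℝ] W), dimH S ≤ d ∧ ∀ A ∉ S,
      Manifold.IsImmersion 𝓘(ℝ, E) 𝓘(ℝ, W) ∞ (fun x ↦ h x + A (g x)) := by
  obtain ⟨s, hs, hcover⟩ := TopologicalSpace.countable_cover_nhds fun x : M ↦
    (chartAt E x).open_source.mem_nhds (mem_chart_source E x)
  refine ⟨⋃ x ∈ s, {A | ∃ v ∈ (chartAt E x).target, ¬ Function.Injective
    (fderiv ℝ (h ∘ (chartAt E x).symm) v + A ∘L fderiv ℝ (g ∘ (chartAt E x).symm) v)}, ?_, ?_⟩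
  · rw [dimH_bUnion hs]
    refine iSup₂_le fun x _ ↦ dimH_not_injective_add_comp_le (chartAt E x).open_target
      ((hg.contDiffOn_comp_chartAt_symm x).fderiv_of_isOpen
        (chartAt E x).open_target (WithTop.coe_le_coe.2 (le_top : (1 + 1 : ℕ∞) ≤ ⊤)))
      ((hh.contDiffOn_comp_chartAt_symm x).fderiv_of_isOpen
        (chartAt E x).open_target (WithTop.coe_le_coe.2 (le_top : (1 + 1 : ℕ∞) ≤ ⊤)))
      (fun v hv ↦ ?_) hd
    have hc := IsManifold.chart_mem_maximalAtlas (I := 𝓘(ℝ, E)) (n := ∞) x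
    have hsymm : MDifferentiableAt 𝓘(ℝ, E) 𝓘(ℝ, E) (chartAt E x).symm v :=
      (contMDiffAt_symm_of_mem_maximalAtlas hc hv).mdifferentiableAt (by simp)
    rw [← mfderiv_eq_fderiv, mfderiv_comp v (hg.contMDiffAt.mdifferentiableAt (by simp)) hsymm]
    refine (hinj _).comp (mfderiv_injective_of_eventually_leftInverse hsymm
      (r := chartAt E x) ?_ ?_)
    · exact (contMDiffAt_of_mem_maximalAtlas hc
        ((chartAt E x).map_target hv)).mdifferentiableAt (by simp)
    · filter_upwards [(chartAt E x).open_target.mem_nhds hv] with y hy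
      simp [hy]
  · intro A hA
    have hsum : ContMDiff 𝓘(ℝ, E) 𝓘(ℝ, W) ∞ (fun x ↦ h x + A (g x)) :=
      hh.add (A.contMDiff.comp hg)
    refine Manifold.IsImmersionOfComplement.isImmersion (F := F) fun y ↦ ?_
    obtain ⟨x, hxs, hyx⟩ := mem_iUnion₂.1 (hcover ▸ mem_univ y)
    refine Manifold.IsImmersionAtOfComplement.of_fderiv_injective hsum
      (IsManifold.chart_mem_maximalAtlas x) hyx ?_ hF
    have hv := (chartAt E x).map_source hyx
    have hmem := (chartAt E x).open_target.mem_nhds hv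
    have hgx := ((hg.contDiffOn_comp_chartAt_symm x).contDiffAt hmem).differentiableAt
      (by simp)
    have hhx := ((hh.contDiffOn_comp_chartAt_symm x).contDiffAt hmem).differentiableAt
      (by simp)
    have hsumx := (hhx.hasFDerivAt.add (A.hasFDerivAt.comp _ hgx.hasFDerivAt)).fderiv
    have heq : (fun x ↦ h x + A (g x)) ∘ (chartAt E x).symm =
      h ∘ (chartAt E x).symm + A ∘ g ∘ (chartAt E x).symm := rfl
    rw [heq, hsumx]
    by_contra hni
    exact hA (mem_iUnion₂.2 ⟨x, hxs, _, hv, hni⟩)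

end

theorem addHaar_eq_zero_of_dimH_lt {X : Type*} [NormedAddCommGroup X] [NormedSpace ℝ X]
    [FiniteDimensional ℝ X] [MeasurableSpace X] [BorelSpace X] (μ : MeasureTheory.Measure X)
    [μ.IsAddHaarMeasure] {s : Set X} {d : ℕ} (hd : d < finrank ℝ X) (hs : dimH s ≤ d) :
    μ s = 0 := by
  refine measure_zero_of_dimH_lt (d := finrank ℝ X) ?_ (hs.trans_lt (by exact_mod_cast hd))
  rw [NNReal.coe_natCast]
  exact MeasureTheory.Measure.absolutelyContinuous_isAddHaarMeasure _ _

theorem corollary5p3 (n m ℓ : ℕ) (hn : 0 < n) (hm : 0 < m) (hℓ : 2 * n ≤ ℓ)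
    {N : Type*} [TopologicalSpace N] [T2Space N] [SecondCountableTopology N]
    [ChartedSpace (EuclideanSpace ℝ (Fin n)) N] [IsManifold (𝓡 n) ∞ N]
    (U : TopologicalSpace.Opens (EuclideanSpace ℝ (Fin m)))
    (f : N → U) (hf : Manifold.IsImmersion (𝓡 n) (𝓡 m) ∞ f)
    (F : U → EuclideanSpace ℝ (Fin ℓ)) (hF : ContMDiff (𝓡 m) (𝓡 ℓ) ∞ F) :
    ∃ S : Set (EuclideanSpace ℝ (Fin m) →ₗ[ℝ] EuclideanSpace ℝ (Fin ℓ)),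
      HasLebesgueMeasureZero S ∧
      ∀ π : EuclideanSpace ℝ (Fin m) →ₗ[ℝ] EuclideanSpace ℝ (Fin ℓ), π ∉ S →
        Manifold.IsImmersion (𝓡 n) (𝓡 ℓ) ∞ (linearPerturbation F π ∘ f) := by
  have hval : ContMDiff (𝓡 m) (𝓡 m) ∞ (Subtype.val : U → EuclideanSpace ℝ (Fin m)) :=
    contMDiff_subtype_val
  have hinj : ∀ x, Function.Injective (mfderiv (𝓡 n) (𝓡 m) (Subtype.val ∘ f) x) := by
    intro x
    rw [mfderiv_comp x (hval.contMDiffAt.mdifferentiableAt (by simp))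
      (hf.contMDiff.contMDiffAt.mdifferentiableAt (by simp))]
    have hincl : Manifold.IsImmersionAtOfComplement PUnit.{1} (𝓡 m) (𝓡 m) ∞
      (Subtype.val : U → EuclideanSpace ℝ (Fin m)) (f x) := .of_opens U (f x)
    exact hincl.mfderiv_injective.comp
      (hf.isImmersionOfComplement_complement x).mfderiv_injective
  -- `linearMapOfCoeffs` as an isomorphism onto continuous linear maps.
  let toCLM : (Fin ℓ → Fin m → ℝ) ≃L[ℝ]
      (EuclideanSpace ℝ (Fin m) →L[ℝ] EuclideanSpace ℝ (Fin ℓ)) :=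
    (Matrix.ofLinearEquiv ℝ ≪≫ₗ Matrix.toEuclideanLin ≪≫ₗ
      LinearMap.toContinuousLinearMap).toContinuousLinearEquiv
  have hrank : finrank ℝ (Fin ℓ → Fin m → ℝ) = ℓ * m := by simp [finrank_pi_fintype]
  have hpos : 0 < ℓ * m := Nat.mul_pos (by omega) hm
  obtain ⟨S, hS, himm⟩ := exists_dimH_le_forall_notMem_isImmersion
    (F := EuclideanSpace ℝ (Fin (ℓ - n))) (d := ℓ * m - 1)
    (hval.comp hf.contMDiff) (hF.comp hf.contMDiff) hinj (by simp; omega)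
    (by rw [← toCLM.toLinearEquiv.finrank_eq, hrank]; simp; omega)
  -- `linearPerturbation F π ∘ f` is `F ∘ f + π ∘ (Subtype.val ∘ f)` by definition.
  refine ⟨{π | LinearMap.toContinuousLinearMap π ∈ S}, ?_, fun π hπ ↦ himm _ hπ⟩
  refine addHaar_eq_zero_of_dimH_lt _ (d := ℓ * m - 1) (by omega) ?_
  refine le_trans (le_of_eq ?_) hS
  exact toCLM.dimH_preimage S
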